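/- A configuration over a finite alphabet $\Sigma$ is a map $x:\mathbb Z^2\to\Sigma$; it is aperiodic if there is no $v\in\mathbb Z^2\setminus\{(0,0)\}$ with $x_{z+v}=x_z$ for all $z\in\mathbb Z^2$. A pattern is a map $\gamma:\Gamma\to\Sigma$ with $\Gamma\subset\mathbb Z^2$ finite, and $x$ avoids $\gamma$ if there is no $z\in\mathbb Z^2$ such that $x_{z+h}=\gamma_h$ for all $h\in\Gamma$. For a finite set $\mathcal F$ of patterns, let $X_{\mathcal F}$ be the $\mathbb Z^2$-subshift of finite type consisting of all configurations that avoid every pattern of $\mathcal F$. Corollary. The following decision problem is $\Pi^0_1$ (co-recursively enumerable), that is, the set of inputs with a negative answer is recursively enumerable. Input: a nonempty finite alphabet $\Sigma=\{0,\dots,k\}$ and a finite set $\mathcal F$ of forbidden patterns over $\Sigma$ (each given explicitly as a finite list of pairs of a position and a letter). Question: does $X_{\mathcal F}$ contain an aperiodic configuration? -/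

import Mathlib

open SymbolicDynamics.FullShift

/-- A configuration of `ℤ²` is aperiodic if it has no period: no nonzero vector `v` satisfies
`x (z + v) = x z` for all `z`. -/
def IsAperiodic {A : Type*} (x : ℤ × ℤ → A) : Prop :=
  ∀ v : ℤ × ℤ, v ≠ 0 → ¬ Function.Periodic x v

/-- `Π⁰₁` (co-recursively enumerable) decision problems: the set of negative instances is
recursively enumerable. -/
def IsPi01 {α : Type*} [Primcodable α] (p : α → Prop) : Prop :=
  REPred fun a => ¬ p a

/-- The table of a pattern: the finite list of its pairs (position, letter). -/
abbrev PatternTable : Type := List ((ℤ × ℤ) × ℕ)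

/-- The table lists the graph of a function from a finite subset of `ℤ²` to the alphabet
`{0, …, k}`. -/
def PatternTable.IsPattern (k : ℕ) (w : PatternTable) : Prop :=
  ∀ e ∈ w, e.2 ≤ k ∧ ∀ e' ∈ w, e'.1 = e.1 → e'.2 = e.2

/-- The pattern with a given table. Its shape is the set of the listed positions, and it maps each
of them to the letter listed with it (by Mathlib's convention a pattern is extended by the default
letter outside its shape). On tables with `PatternTable.IsPattern k` the reduction of letters
modulo `k + 1` that is built into `Fin.ofNat` changes nothing. -/
def PatternTable.toPattern (k : ℕ) (w : PatternTable) : Pattern (Fin (k + 1)) (ℤ × ℤ) where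
  config z := match w.lookup z with
    | some a => Fin.ofNat (k + 1) a
    | none => default
  support := (w.map Prod.fst).toFinset
  condition z hz := by
    have h : w.lookup z = none := by
      rw [List.lookup_eq_none_iff]
      intro e he
      simp only [List.mem_toFinset, List.mem_map, not_exists, not_and] at hz
      simpa using fun h => hz e he h.symm
    simp only [h]

/-- A word `(k, L)` is an input if every member of the list `L` is the table of a pattern over the
alphabet `{0, …, k}`. -/
def IsForbiddenInput (c : ℕ × List PatternTable) : Prop :=
  ∀ w ∈ c.2, w.IsPattern c.1

instance : DecidablePred IsForbiddenInput := fun c => by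
  unfold IsForbiddenInput PatternTable.IsPattern
  infer_instance

theorem primrecPred_isForbiddenInput : PrimrecPred IsForbiddenInput := by
  have h1 : PrimrecRel fun (e' e : (ℤ × ℤ) × ℕ) => e'.1 = e.1 → e'.2 = e.2 := by
    have ha : PrimrecPred fun p : ((ℤ × ℤ) × ℕ) × ((ℤ × ℤ) × ℕ) => p.1.1 = p.2.1 :=
      Primrec.eq.comp (Primrec.fst.comp Primrec.fst) (Primrec.fst.comp Primrec.snd)
    have hb : PrimrecPred fun p : ((ℤ × ℤ) × ℕ) × ((ℤ × ℤ) × ℕ) => p.1.2 = p.2.2 :=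
      Primrec.eq.comp (Primrec.snd.comp Primrec.fst) (Primrec.snd.comp Primrec.snd)
    exact (ha.not.or hb).of_eq fun p => by tauto
  have h2 : PrimrecRel fun (e : (ℤ × ℤ) × ℕ) (q : ℕ × PatternTable) =>
      e.2 ≤ q.1 ∧ ∀ e' ∈ q.2, e'.1 = e.1 → e'.2 = e.2 :=
    (Primrec.nat_le.comp (Primrec.snd.comp Primrec.fst) (Primrec.fst.comp Primrec.snd)).and
      (h1.forall_mem_list.comp (Primrec.snd.comp Primrec.snd) Primrec.fst)
  have h3 : PrimrecRel fun (w : PatternTable) (k : ℕ) => w.IsPattern k :=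
    h2.forall_mem_list.comp Primrec.fst (Primrec.pair Primrec.snd Primrec.fst)
  exact h3.forall_mem_list.comp Primrec.snd Primrec.fst

/-- The inputs of the decision problem: a nonempty finite alphabet `{0, …, k}` together with a
finite list of patterns over it, each given by its table. -/
def ForbiddenInput : Type := { c : ℕ × List PatternTable // IsForbiddenInput c }

instance : Primcodable ForbiddenInput := Primcodable.subtype primrecPred_isForbiddenInput

/-- The set of patterns over `{0, …, k}` given by a list of tables. -/
def patternSet (k : ℕ) (L : List PatternTable) : Set (Pattern (Fin (k + 1)) (ℤ × ℤ)) :=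
  { p | ∃ w ∈ L, w.toPattern k = p }

/-- The alphabet of an input. -/
abbrev ForbiddenInput.Alphabet (c : ForbiddenInput) : Type := Fin (c.1.1 + 1)

/-- The finite set of forbidden patterns given by an input. -/
def ForbiddenInput.patterns (c : ForbiddenInput) : Set (Pattern c.Alphabet (ℤ × ℤ)) :=
  patternSet c.1.1 c.1.2

/-- The `ℤ²`-subshift of finite type of all configurations that avoid the forbidden patterns. -/
def ForbiddenInput.sft (c : ForbiddenInput) : Subshift c.Alphabet (ℤ × ℤ) :=
  Subshift.ofForbidden c.patterns

/-- The pattern of a table carries at each listed position the letter listed there. -/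
theorem PatternTable.IsPattern.config_eq {k : ℕ} {w : PatternTable} (hw : w.IsPattern k)
    {z : ℤ × ℤ} {a : ℕ} (h : (z, a) ∈ w) : ((w.toPattern k).config z : ℕ) = a := by
  cases hl : w.lookup z with
  | none =>
    rw [List.lookup_eq_none_iff] at hl
    simpa using hl _ h
  | some b =>
    obtain ⟨l₁, l₂, rfl, -⟩ := List.lookup_eq_some_iff.1 hl
    have hb : a = b := ((hw (z, b) (by simp)).2 (z, a) h rfl)
    have hk : a ≤ k := (hw _ h).1
    subst hb
    simp only [PatternTable.toPattern, hl, Fin.val_ofNat]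
    exact Nat.mod_eq_of_lt (by omega)

/-- Every finite set of patterns over `{0, …, k}` is given by some input. -/
theorem exists_forbiddenInput (k : ℕ) (F : Set (Pattern (Fin (k + 1)) (ℤ × ℤ))) (hF : F.Finite) :
    ∃ L : List PatternTable, IsForbiddenInput (k, L) ∧ patternSet k L = F := by
  let t : Pattern (Fin (k + 1)) (ℤ × ℤ) → PatternTable := fun p =>
    p.support.toList.map fun z => (z, (p.config z : ℕ))
  have ht : ∀ p, (t p).IsPattern k := by
    intro p e he
    obtain ⟨z, -, rfl⟩ := List.mem_map.1 he
    refine ⟨Nat.lt_succ_iff.1 (p.config z).2, fun e' he' h => ?_⟩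
    obtain ⟨z', -, rfl⟩ := List.mem_map.1 he'
    simp only at h
    rw [h]
  have hs : ∀ p, ((t p).toPattern k).support = p.support := by
    intro p
    ext z
    simp [PatternTable.toPattern, t]
  have hp : ∀ p, (t p).toPattern k = p := by
    intro p
    have hc : ((t p).toPattern k).config = p.config := by
      funext z
      by_cases hz : z ∈ p.support
      · exact Fin.ext ((ht p).config_eq
          (List.mem_map.2 ⟨z, Finset.mem_toList.2 hz, rfl⟩))
      · rw [p.condition z hz, ((t p).toPattern k).condition z (by rwa [hs])]
    have hsp := hs p
    revert hc hsp
    generalize (t p).toPattern k = q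
    intro hc hsp
    cases p
    cases q
    simp only at hc hsp
    subst hc hsp
    rfl
  refine ⟨hF.toFinset.toList.map t, ?_, ?_⟩
  · intro w hw
    obtain ⟨p, -, rfl⟩ := List.mem_map.1 hw
    exact ht p
  · ext p
    simp [patternSet, hp]

/-! ### Local breaks of periods -/

/-- The sup norm of an integer vector, as a natural number. -/
def supNorm (v : ℤ × ℤ) : ℕ := max v.1.natAbs v.2.natAbs

theorem supNorm_le {v : ℤ × ℤ} {n : ℕ} :
    supNorm v ≤ n ↔ v.1.natAbs ≤ n ∧ v.2.natAbs ≤ n := max_le_iff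

theorem supNorm_zsmul (j : ℤ) (v : ℤ × ℤ) : supNorm (j • v) = j.natAbs * supNorm v := by
  simp [supNorm, Int.natAbs_mul]

theorem supNorm_add_le (v w : ℤ × ℤ) : supNorm (v + w) ≤ supNorm v + supNorm w := by
  simp only [supNorm, Prod.fst_add, Prod.snd_add]
  omega

theorem supNorm_neg (v : ℤ × ℤ) : supNorm (-v) = supNorm v := by
  simp [supNorm]

theorem supNorm_sub_le (v w : ℤ × ℤ) : supNorm (v - w) ≤ supNorm v + supNorm w := by
  rw [sub_eq_add_neg, ← supNorm_neg w]
  exact supNorm_add_le _ _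

/-- The configuration `x` fails to be `p`-periodic at some position at distance at most `D`
from `z`. -/
def BrokenNear {A : Type*} (x : ℤ × ℤ → A) (p z : ℤ × ℤ) (D : ℕ) : Prop :=
  ∃ y, supNorm (y - z) ≤ D ∧ x (y + p) ≠ x y

/-- One of the two vectors is a multiple of the other, or they are linearly independent. -/
def Comparable (p q : ℤ × ℤ) : Prop :=
  (∃ c : ℤ, q = c • p) ∨ (∃ c : ℤ, p = c • q) ∨ p.1 * q.2 - p.2 * q.1 ≠ 0

section
variable {A : Type*} {x : ℤ × ℤ → A}

theorem BrokenNear.recenter {p z z' : ℤ × ℤ} {D E : ℕ} (h : BrokenNear x p z D)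
    (hE : supNorm (z - z') + D ≤ E) : BrokenNear x p z' E := by
  obtain ⟨y, hy, hxy⟩ := h
  refine ⟨y, ?_, hxy⟩
  have := supNorm_add_le (y - z) (z - z')
  rw [sub_add_sub_cancel] at this
  omega

theorem BrokenNear.mono {p z : ℤ × ℤ} {D E : ℕ} (h : BrokenNear x p z D) (hE : D ≤ E) :
    BrokenNear x p z E :=
  h.recenter (by simpa [supNorm] using hE)

/-- If every step of the chain `y`, `y + a`, … preserved the value, so would the whole jump. -/
theorem exists_ne_of_nsmul {a : ℤ × ℤ} (n : ℕ) {y : ℤ × ℤ} (h : x (y + n • a) ≠ x y) :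
    ∃ j < n, x (y + j • a + a) ≠ x (y + j • a) := by
  induction n with
  | zero => simp at h
  | succ n ih =>
    by_cases hn : x (y + n • a) = x y
    · refine ⟨n, by omega, ?_⟩
      rw [hn, add_assoc, ← succ_nsmul]
      exact h
    · obtain ⟨j, hj, h'⟩ := ih hn
      exact ⟨j, by omega, h'⟩

theorem BrokenNear.of_zsmul {a z : ℤ × ℤ} {c : ℤ} {D : ℕ} (h : BrokenNear x (c • a) z D) :
    BrokenNear x a z (D + supNorm (c • a)) := by
  obtain ⟨y, hy, hxy⟩ := h
  rw [supNorm_zsmul]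
  have key : ∃ j : ℤ, j.natAbs ≤ c.natAbs ∧ x (y + j • a + a) ≠ x (y + j • a) := by
    obtain ⟨n, rfl | rfl⟩ := c.eq_nat_or_neg
    · rw [natCast_zsmul] at hxy
      obtain ⟨j, hj, h'⟩ := exists_ne_of_nsmul n hxy
      exact ⟨j, by simp; omega, by simpa using h'⟩
    -- A negative multiple is read as a positive one from the other endpoint.
    · have hxy' : x ((y + (-(n : ℤ)) • a) + n • a) ≠ x (y + (-(n : ℤ)) • a) := by
        have : (y + (-(n : ℤ)) • a) + n • a = y := by
          rw [neg_smul, natCast_zsmul, neg_add_cancel_right]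
        rw [this]
        exact hxy.symm
      obtain ⟨j, hj, h'⟩ := exists_ne_of_nsmul n hxy'
      refine ⟨-n + j, by omega, ?_⟩
      rwa [add_smul, ← add_assoc, natCast_zsmul a j]
  obtain ⟨j, hj, h'⟩ := key
  refine ⟨_, ?_, h'⟩
  have h1 := supNorm_add_le (y - z) (j • a)
  rw [supNorm_zsmul] at h1
  have h2 := Nat.mul_le_mul_right (supNorm a) hj
  rw [show y + j • a - z = y - z + j • a by abel]
  omega

/-- If `x` is `b`-periodic near `z`, a break of `v` at `y` recurs at `y + b` and `y - b`. The margin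
`2 * m` covers the farthest point used, `y - b + v`. -/
theorem brokenNear_or_translate {S : Set (ℤ × ℤ)} {b z : ℤ × ℤ} {m D : ℕ}
    (hS : ∀ v ∈ S, supNorm v ≤ m) (hb : supNorm b ≤ m) (hz : ∀ v ∈ S, BrokenNear x v z D) :
    BrokenNear x b z (D + 2 * m) ∨
      (∀ v ∈ S, BrokenNear x v (z + b) D) ∧ ∀ v ∈ S, BrokenNear x v (z - b) D := by
  by_cases h : BrokenNear x b z (D + 2 * m)
  · exact Or.inl h
  have hper : ∀ y, supNorm (y - z) ≤ D + 2 * m → x (y + b) = x y := by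
    intro y hy
    by_contra hne
    exact h ⟨y, hy, hne⟩
  refine Or.inr ⟨fun v hv => ?_, fun v hv => ?_⟩
  · obtain ⟨y, hy, hxy⟩ := hz v hv
    refine ⟨y + b, by simpa using hy, ?_⟩
    have h1 := supNorm_add_le (y - z) v
    have h2 := hS v hv
    rw [add_right_comm, hper y (by omega), hper (y + v) ?_]
    · exact hxy
    · rw [show y + v - z = y - z + v by abel]
      omega
  · obtain ⟨y, hy, hxy⟩ := hz v hv
    refine ⟨y - b, by simpa using hy, ?_⟩
    have h1 := supNorm_sub_le (y - z) b
    have h2 := supNorm_add_le (y - z - b) v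
    have h3 := hS v hv
    have e1 := hper (y - b) (by rw [show y - b - z = y - z - b by abel]; omega)
    have e2 := hper (y - b + v) (by rw [show y - b + v - z = y - z - b + v by abel]; omega)
    rw [sub_add_cancel] at e1
    rw [show y - b + v + b = y + v by abel] at e2
    rw [← e1, ← e2]
    exact hxy

theorem brokenNear_or_translates {S : Set (ℤ × ℤ)} {b z : ℤ × ℤ} {m D : ℕ}
    (hS : ∀ v ∈ S, supNorm v ≤ m) (hb : supNorm b ≤ m) (hz : ∀ v ∈ S, BrokenNear x v z D)
    (J : ℕ) :
    (∃ j : ℤ, j.natAbs ≤ J ∧ (∀ v ∈ S, BrokenNear x v (z + j • b) D) ∧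
      BrokenNear x b (z + j • b) (D + 2 * m)) ∨
      ∀ j : ℤ, j.natAbs ≤ J → ∀ v ∈ S, BrokenNear x v (z + j • b) D := by
  induction J with
  | zero =>
    refine Or.inr fun j hj => ?_
    obtain rfl : j = 0 := by omega
    simpa using hz
  | succ J ih =>
    rcases ih with ⟨j, hj, h⟩ | h
    · exact Or.inl ⟨j, by omega, h⟩
    rcases brokenNear_or_translate hS hb (h J (by simp)) with h1 | ⟨h1, -⟩
    · exact Or.inl ⟨J, by simp, h J (by simp), h1⟩
    rcases brokenNear_or_translate hS hb (h (-J) (by simp)) with h2 | ⟨-, h2⟩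
    · exact Or.inl ⟨-J, by simp, h (-J) (by simp), h2⟩
    refine Or.inr fun j hj => ?_
    by_cases hj' : j.natAbs ≤ J
    · exact h j hj'
    obtain rfl | rfl : j = J + 1 ∨ j = -J - 1 := by omega
    · rwa [add_smul, one_smul, ← add_assoc]
    · rwa [sub_smul, one_smul, ← add_sub_assoc]

/-! ### Gathering the breaks of finitely many vectors -/

theorem natAbs_det_le {v w : ℤ × ℤ} {m n : ℕ} (hv : supNorm v ≤ m) (hw : supNorm w ≤ n) :
    (v.1 * w.2 - v.2 * w.1).natAbs ≤ 2 * m * n := by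
  rw [supNorm_le] at hv hw
  have h1 := Nat.mul_le_mul hv.1 hw.2
  have h2 := Nat.mul_le_mul hv.2 hw.1
  rw [← Int.natAbs_mul] at h1 h2
  rw [mul_assoc]
  generalize m * n = k at *
  omega

theorem natAbs_le_of_mul_eq {d s t r a b : ℤ} {m : ℕ} (hd : d ≠ 0) (h : d * r = s * b + t * a)
    (hs : s.natAbs ≤ d.natAbs) (ht : t.natAbs ≤ d.natAbs) (ha : a.natAbs ≤ m)
    (hb : b.natAbs ≤ m) : r.natAbs ≤ 2 * m := by
  have h1 := Nat.mul_le_mul hs hb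
  have h2 := Nat.mul_le_mul ht ha
  rw [← Int.natAbs_mul] at h1 h2
  have h3 : d.natAbs * r.natAbs ≤ d.natAbs * (2 * m) := by
    rw [← Int.natAbs_mul, h, mul_left_comm]
    generalize d.natAbs * m = k at *
    omega
  exact Nat.le_of_mul_le_mul_left h3 (by omega)

/-- Lines with independent directions `a` and `b` pass close to each other. -/
theorem exists_close_of_det_ne_zero {a b w : ℤ × ℤ} {m E : ℕ} (ha : supNorm a ≤ m)
    (hb : supNorm b ≤ m) (hw : supNorm w ≤ E) (hd : a.1 * b.2 - a.2 * b.1 ≠ 0) :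
    ∃ i j : ℤ, i.natAbs ≤ 2 * E * m ∧ j.natAbs ≤ 2 * E * m ∧
      supNorm (w - i • b - j • a) ≤ 2 * m := by
  -- Cramer's rule gives `d • w = P • b + Q • a`. After integer division by `d`, the error times `d`
  -- is `(P % d) • b + (Q % d) • a`, with coefficients at most `|d|`.
  set d := a.1 * b.2 - a.2 * b.1 with hdef
  set P := -(w.1 * a.2 - w.2 * a.1) with hP
  set Q := w.1 * b.2 - w.2 * b.1 with hQ
  have hPb : P.natAbs ≤ 2 * E * m := by
    rw [hP, Int.natAbs_neg]
    exact natAbs_det_le hw ha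
  have hQb : Q.natAbs ≤ 2 * E * m := natAbs_det_le hw hb
  have e1 := Int.emod_add_mul_ediv P d
  have e2 := Int.emod_add_mul_ediv Q d
  have s1 : (P % d).natAbs ≤ d.natAbs := by
    have := Int.emod_nonneg P hd
    have := Int.emod_lt P hd
    omega
  have s2 : (Q % d).natAbs ≤ d.natAbs := by
    have := Int.emod_nonneg Q hd
    have := Int.emod_lt Q hd
    omega
  refine ⟨P / d, Q / d, (Int.natAbs_ediv_le_natAbs _ _).trans hPb, (Int.natAbs_ediv_le_natAbs _ _).trans hQb, ?_⟩
  rw [supNorm_le] at ha hb ⊢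
  refine ⟨natAbs_le_of_mul_eq hd ?_ s1 s2 ha.1 hb.1, natAbs_le_of_mul_eq hd ?_ s1 s2 ha.2 hb.2⟩
  · simp only [Prod.fst_sub, Prod.smul_fst, smul_eq_mul]
    linear_combination (-b.1) * e1 + (-a.1) * e2 + w.1 * hdef + b.1 * hP + a.1 * hQ
  · simp only [Prod.snd_sub, Prod.smul_snd, smul_eq_mul]
    linear_combination (-b.2) * e1 + (-a.2) * e2 + w.2 * hdef + b.2 * hP + a.2 * hQ

/-- If finitely many pairwise comparable vectors are broken near `z`, then not too far from `z`
they are all broken within a distance that depends only on their number and size. -/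
theorem exists_forall_brokenNear {m : ℕ} (n : ℕ) : ∀ l : List (ℤ × ℤ), l.length = n →
    (∀ v ∈ l, supNorm v ≤ m) → l.Pairwise Comparable → ∀ (E : ℕ) (z : ℤ × ℤ),
    (∀ v ∈ l, BrokenNear x v z E) → ∃ z', supNorm (z' - z) ≤ E * (4 * m * m + 1) ^ n ∧
      ∀ v ∈ l, BrokenNear x v z' (2 * m * n) := by
  induction n with
  | zero =>
    intro l hl _ _ E z _
    obtain rfl := List.length_eq_zero_iff.1 hl
    exact ⟨z, by simp [supNorm], by simp⟩
  | succ n ih =>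
    intro l hl hm hc E z hz
    match l, hl with
    | [a], hl =>
      obtain ⟨y, hy, hxy⟩ := hz a (by simp)
      refine ⟨y, hy.trans (Nat.le_mul_of_pos_right _ (by positivity)), ?_⟩
      simp only [List.mem_singleton, forall_eq]
      exact ⟨y, by simp [supNorm], hxy⟩
    | a :: b :: l, hl =>
      simp only [List.forall_mem_cons, List.pairwise_cons, List.length_cons] at hl hm hc hz
      obtain ⟨ha, hb, hm⟩ := hm
      obtain ⟨⟨hab, hal⟩, hbl, hc⟩ := hc
      obtain ⟨za, zb, zl⟩ := hz
      have hn : l.length + 1 = n := by omega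
      set K := 4 * m * m + 1 with hK
      set h := E * K ^ n with hh
      have hhK : E * K ^ (n + 1) = h + 4 * h * m * m := by rw [pow_succ, ← mul_assoc, ← hh, hK]; ring
      have hD : 2 * m * (n + 1) = 2 * m * n + 2 * m := by ring
      -- Two clusters: near `z₁` only `b` may be missing, near `z₂` only `a`.
      obtain ⟨z₁, hz₁, B₁⟩ := ih (a :: l) (by simpa using hn)
        (List.forall_mem_cons.2 ⟨ha, hm⟩) (List.pairwise_cons.2 ⟨hal, hc⟩) E z
        (List.forall_mem_cons.2 ⟨za, zl⟩)
      obtain ⟨z₂, hz₂, B₂⟩ := ih (b :: l) (by simpa using hn)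
        (List.forall_mem_cons.2 ⟨hb, hm⟩) (List.pairwise_cons.2 ⟨hbl, hc⟩) E z
        (List.forall_mem_cons.2 ⟨zb, zl⟩)
      rw [hhK, hD]
      rcases hab with ⟨c, rfl⟩ | ⟨c, rfl⟩ | hdet
      · refine ⟨z₂, by omega, List.forall_mem_cons.2 ⟨?_, fun v hv => (B₂ v hv).mono (by omega)⟩⟩
        exact (B₂ _ List.mem_cons_self).of_zsmul.mono (by omega)
      · refine ⟨z₁, by omega, List.forall_mem_cons.2 ⟨(B₁ _ List.mem_cons_self).mono (by omega),
          List.forall_mem_cons.2 ⟨?_, fun v hv => (B₁ v (List.mem_cons_of_mem _ hv)).mono (by omega)⟩⟩⟩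
        exact (B₁ _ List.mem_cons_self).of_zsmul.mono (by omega)
      -- The centres are at most `2 * h` apart, so slides of `2 * (2 * h) * m` steps reach the
      -- near-crossing. They cover at most `4 * h * m * m`, which accounts for the factor `K`.
      · have far : ∀ (j : ℤ) (c y : ℤ × ℤ), j.natAbs ≤ 2 * (2 * h) * m → supNorm c ≤ m →
            supNorm (y - z) ≤ h → supNorm (y + j • c - z) ≤ h + 4 * h * m * m := by
          intro j c y hj hc hy
          have h1 := supNorm_add_le (y - z) (j • c)
          have h2 := Nat.mul_le_mul hj hc
          rw [supNorm_zsmul] at h1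
          rw [show y + j • c - z = y - z + j • c by abel]
          have h3 : 2 * (2 * h) * m * m = 4 * h * m * m := by ring
          omega
        rcases brokenNear_or_translates (S := {v | v ∈ a :: l}) (List.forall_mem_cons.2 ⟨ha, hm⟩) hb
          B₁ (2 * (2 * h) * m) with ⟨j, hj, h1, h2⟩ | L₁
        · refine ⟨z₁ + j • b, far _ _ _ hj hb hz₁, List.forall_mem_cons.2
            ⟨(h1 a List.mem_cons_self).mono (by omega), List.forall_mem_cons.2 ⟨h2, fun v hv =>
            (h1 v (List.mem_cons_of_mem _ hv)).mono (by omega)⟩⟩⟩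
        rcases brokenNear_or_translates (S := {v | v ∈ b :: l}) (List.forall_mem_cons.2 ⟨hb, hm⟩) ha
          B₂ (2 * (2 * h) * m) with ⟨j, hj, h1, h2⟩ | L₂
        · exact ⟨z₂ + j • a, far _ _ _ hj ha hz₂, List.forall_mem_cons.2
            ⟨h2, fun v hv => (h1 v hv).mono (by omega)⟩⟩
        -- Neither slide met the missing break, so both clusters persist up to the near-crossing,
        -- where the second supplies the break of `b` at an extra cost of `2 * m`.
        have hw : supNorm (z₂ - z₁) ≤ 2 * h := by
          have := supNorm_sub_le (z₂ - z) (z₁ - z)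
          rw [sub_sub_sub_cancel_right] at this
          omega
        obtain ⟨i, j, hi, hj, hij⟩ := exists_close_of_det_ne_zero ha hb hw hdet
        have G₁ := L₁ i hi
        have G₂ := L₂ (-j) (by omega)
        refine ⟨z₁ + i • b, far _ _ _ hi hb hz₁, List.forall_mem_cons.2
          ⟨(G₁ a List.mem_cons_self).mono (by omega), List.forall_mem_cons.2
          ⟨(G₂ b List.mem_cons_self).recenter ?_, fun v hv =>
            (G₁ v (List.mem_cons_of_mem _ hv)).mono (by omega)⟩⟩⟩
        rw [show z₂ + -j • a - (z₁ + i • b) = z₂ - z₁ - i • b - j • a by rw [neg_smul]; abel]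
        omega

end

/-! ### Radii independent of the number of vectors -/

/-- The accumulated displacement in `exists_nested_brokenNear`. -/
def driftBound (M : ℕ → ℕ) : ℕ → ℕ
  | 0 => 0
  | k + 1 => driftBound M k + 2 * M (k + 1) * (k + 1) * (4 * M k * M k + 1) ^ k

/-- The radius within which the `k`-th vector is broken in `exists_nested_brokenNear`. -/
def breakRadius (M : ℕ → ℕ) (k : ℕ) : ℕ :=
  2 * M (k + 1) * (k + 1) + driftBound M (k + 1)

/-- If the first `k` vectors of a sequence are broken, then there is a position such that the `i`-th
vector, for each `i < k`, is broken within a distance that does not depend on `k`. -/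
theorem exists_nested_brokenNear {A : Type*} {x : ℤ × ℤ → A} {p : ℕ → ℤ × ℤ} {M : ℕ → ℕ}
    (hM : ∀ i k, i < k → supNorm (p i) ≤ M k) (hp : ∀ i k, i < k → Comparable (p i) (p k))
    (k : ℕ) : ∀ (E : ℕ) (z : ℤ × ℤ), (∀ i < k, BrokenNear x (p i) z E) →
      ∃ z', supNorm (z' - z) ≤ E * (4 * M k * M k + 1) ^ k + driftBound M k ∧
        ∀ i < k, BrokenNear x (p i) z' (breakRadius M i) := by
  induction k with
  | zero => exact fun E z _ => ⟨z, by simp [supNorm], by simp⟩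
  | succ k ih =>
    intro E z hz
    -- Gathering all `k + 1` vectors first replaces `E` by a radius depending only on `k`. The
    -- induction hypothesis then moves the centre by at most `driftBound M (k + 1)`, so the last
    -- vector stays within `breakRadius M k`.
    obtain ⟨z₁, h₁, B₁⟩ := exists_forall_brokenNear (x := x) (m := M (k + 1)) (k + 1)
      ((List.range (k + 1)).map p) (by simp)
      (by
        simp only [List.mem_map, List.mem_range, forall_exists_index, and_imp,
          forall_apply_eq_imp_iff₂]
        exact fun i hi => hM i _ hi)
      (List.pairwise_map.2 (List.pairwise_lt_range.imp fun h => hp _ _ h)) E z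
      (by simpa using hz)
    simp only [List.mem_map, List.mem_range, forall_exists_index, and_imp,
      forall_apply_eq_imp_iff₂] at B₁
    obtain ⟨z₂, h₂, B₂⟩ := ih _ z₁ fun i hi => B₁ i (by omega)
    have h₂' : supNorm (z₂ - z₁) ≤ driftBound M (k + 1) := by
      rw [driftBound]
      omega
    refine ⟨z₂, ?_, fun i hi => ?_⟩
    · have := supNorm_add_le (z₂ - z₁) (z₁ - z)
      rw [sub_add_sub_cancel] at this
      omega
    · rcases Nat.lt_succ_iff_lt_or_eq.1 hi with hi | rfl
      · exact B₂ i hi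
      · refine (B₁ i (by omega)).recenter ?_
        rw [← neg_sub, supNorm_neg, breakRadius]
        omega

/-! ### The test vectors -/

/-- For parallel `v` and `w`, `v.1 • w = w.1 • v` and likewise for second coordinates, so a nonzero
coordinate of `v` that divides out of `h` turns `h • w` into an integer multiple of `g • v`.
Otherwise the determinant survives scaling. -/
theorem comparable_smul_smul {v w : ℤ × ℤ} {g h : ℤ} (hv : v ≠ 0)
    (h₁ : v.1 ≠ 0 → v.1 * g ∣ h) (h₂ : v.2 ≠ 0 → v.2 * g ∣ h) (hg : g ≠ 0) (hh : h ≠ 0) :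
    Comparable (g • v) (h • w) := by
  by_cases hdet : v.1 * w.2 = v.2 * w.1
  · refine Or.inl ?_
    by_cases hv1 : v.1 = 0
    · have hv2 : v.2 ≠ 0 := fun h => hv (Prod.ext hv1 h)
      obtain ⟨q, rfl⟩ := h₂ hv2
      refine ⟨q * w.2, Prod.ext ?_ ?_⟩
      · simp only [Prod.smul_fst, smul_eq_mul]
        linear_combination (-g * q) * hdet
      · simp only [Prod.smul_snd, smul_eq_mul]
        ring
    · obtain ⟨q, rfl⟩ := h₁ hv1
      refine ⟨q * w.1, Prod.ext ?_ ?_⟩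
      · simp only [Prod.smul_fst, smul_eq_mul]
        ring
      · simp only [Prod.smul_snd, smul_eq_mul]
        linear_combination (g * q) * hdet
  · refine Or.inr (Or.inr ?_)
    have : g * h * (v.1 * w.2 - v.2 * w.1) ≠ 0 :=
      mul_ne_zero (mul_ne_zero hg hh) (sub_ne_zero.2 hdet)
    simp only [Prod.smul_fst, Prod.smul_snd, smul_eq_mul]
    convert this using 1
    ring

/-- A sequence of multipliers in which `(k + 1) * periodFactor k` divides the later members. -/
def periodFactor (k : ℕ) : ℕ := k.factorial ^ k

theorem periodFactor_pos (k : ℕ) : 0 < periodFactor k := pow_pos k.factorial_pos k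

/-- The power of `k.factorial` has at least one factor to spare beyond the first `j`, and it absorbs
`s ≤ k`. -/
theorem mul_periodFactor_dvd {s j k : ℕ} (hs : s ≠ 0) (hsj : s ≤ j + 1) (hjk : j < k) :
    s * periodFactor j ∣ periodFactor k := by
  obtain ⟨d, rfl⟩ := Nat.exists_eq_add_of_lt hjk
  rw [periodFactor, periodFactor, show j + d + 1 = (d + 1) + j by ring, pow_add]
  refine mul_dvd_mul ?_ (pow_dvd_pow_of_dvd (Nat.factorial_dvd_factorial (by omega)) _)
  exact (Nat.dvd_factorial (by omega) (by omega)).trans (dvd_pow_self _ (by omega))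

theorem periodFactor_mono {j k : ℕ} (h : j ≤ k) : periodFactor j ≤ periodFactor k := by
  rcases h.eq_or_lt with rfl | h
  · rfl
  · have := mul_periodFactor_dvd one_ne_zero (by omega) h
    rw [one_mul] at this
    exact Nat.le_of_dvd (periodFactor_pos k) this

/-- A sequence of nonzero vectors in which every nonzero vector or its opposite occurs. -/
def nonzeroVector (k : ℕ) : ℤ × ℤ :=
  if k.unpair.1 = 0 ∧ k.unpair.2.unpair.1 = k.unpair.2.unpair.2 then (0, 1)
  else ((k.unpair.1 : ℤ), (k.unpair.2.unpair.1 : ℤ) - k.unpair.2.unpair.2)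

theorem nonzeroVector_ne_zero (k : ℕ) : nonzeroVector k ≠ 0 := by
  unfold nonzeroVector
  split_ifs with h
  · simp
  · simp only [ne_eq, Prod.mk_eq_zero]
    omega

theorem supNorm_nonzeroVector_le (k : ℕ) : supNorm (nonzeroVector k) ≤ k + 1 := by
  unfold nonzeroVector
  split_ifs with h
  · simp [supNorm]
  · have h1 := k.unpair_left_le
    have h2 := k.unpair_right_le
    have h3 := k.unpair.2.unpair_left_le
    have h4 := k.unpair.2.unpair_right_le
    rw [supNorm_le]
    simp only
    omega

theorem exists_nonzeroVector_eq {v : ℤ × ℤ} (hv : v ≠ 0) :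
    ∃ k, nonzeroVector k = v ∨ nonzeroVector k = -v := by
  have key : ∀ w : ℤ × ℤ, w ≠ 0 → 0 ≤ w.1 → ∃ k, nonzeroVector k = w := by
    intro w hw h
    refine ⟨Nat.pair w.1.toNat (Nat.pair w.2.toNat (-w.2).toNat), ?_⟩
    have h2 : (w.2.toNat : ℤ) - (-w.2).toNat = w.2 := by omega
    have h1 : (w.1.toNat : ℤ) = w.1 := by omega
    unfold nonzeroVector
    simp only [Nat.unpair_pair]
    rw [if_neg, h1, h2]
    rintro ⟨h3, h4⟩
    exact hw (Prod.ext (by simp; omega) (by simp; omega))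
  rcases le_total 0 v.1 with h | h
  · exact (key v hv h).imp fun _ => Or.inl
  · exact (key (-v) (neg_ne_zero.2 hv) (by simpa using h)).imp fun _ => Or.inr

/-- A sequence of pairwise comparable nonzero vectors containing a multiple of every vector. -/
def testVector (k : ℕ) : ℤ × ℤ := (periodFactor k : ℤ) • nonzeroVector k

/-- A bound for the norms of `testVector i` with `i < k`. -/
def testBound (k : ℕ) : ℕ := periodFactor k * (k + 1)

theorem supNorm_testVector_le {i k : ℕ} (h : i < k) : supNorm (testVector i) ≤ testBound k := by
  rw [testVector, supNorm_zsmul, Int.natAbs_natCast, testBound]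
  exact Nat.mul_le_mul (periodFactor_mono h.le) ((supNorm_nonzeroVector_le i).trans (by omega))

theorem comparable_testVector {i k : ℕ} (h : i < k) :
    Comparable (testVector i) (testVector k) := by
  have hle := supNorm_le.1 (supNorm_nonzeroVector_le i)
  have hdvd : ∀ s : ℤ, s.natAbs ≤ i + 1 → s ≠ 0 → s * periodFactor i ∣ periodFactor k := by
    intro s hs h0
    rw [← Int.natAbs_dvd_natAbs, Int.natAbs_mul]
    exact mul_periodFactor_dvd (by simpa using h0) hs h
  exact comparable_smul_smul (nonzeroVector_ne_zero i) (hdvd _ hle.1) (hdvd _ hle.2)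
    (by exact_mod_cast (periodFactor_pos i).ne') (by exact_mod_cast (periodFactor_pos k).ne')

/-- Multiples of a period are periods, and every nonzero vector has a nonzero multiple in the
sequence. -/
theorem isAperiodic_iff_forall_testVector {A : Type*} {x : ℤ × ℤ → A} :
    IsAperiodic x ↔ ∀ k, ¬ Function.Periodic x (testVector k) := by
  refine ⟨fun h k => h _ ?_, fun h v hv hper => ?_⟩
  · exact smul_ne_zero (by exact_mod_cast (periodFactor_pos k).ne') (nonzeroVector_ne_zero k)
  · obtain ⟨k, hk | hk⟩ := exists_nonzeroVector_eq hv
    · refine h k ?_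
      rw [testVector, hk]
      exact hper.zsmul _
    · refine h k ?_
      rw [testVector, hk]
      exact hper.neg.zsmul _

/-! ### Local certificates and compactness -/

/-- A bound for the codes of the positions `z` and `z + testVector i` for `z` at distance at most
`breakRadius testBound i` from the origin. -/
def breakWindow (i : ℕ) : ℕ := (2 * (breakRadius testBound i + testBound (i + 1)) + 1) ^ 2

theorem encode_int_le (a : ℤ) : Encodable.encode a ≤ 2 * a.natAbs := by
  cases a with
  | ofNat n =>
    have : Encodable.encode (Int.ofNat n) = 2 * n := rfl
    exact this.le
  | negSucc n =>
    have : Encodable.encode (Int.negSucc n) = 2 * n + 1 := rfl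
    simp only [this, Int.natAbs_negSucc]
    omega

theorem encode_lt_of_supNorm_le {z : ℤ × ℤ} {n : ℕ} (h : supNorm z ≤ n) :
    Encodable.encode z < (2 * n + 1) ^ 2 := by
  rw [supNorm_le] at h
  have h1 := encode_int_le z.1
  have h2 := encode_int_le z.2
  rw [Encodable.encode_prod_val]
  refine (Nat.pair_lt_max_add_one_sq _ _).trans_le (Nat.pow_le_pow_left ?_ 2)
  omega

open Encodable Denumerable

/-- On the positions with code less than `n`, the configuration `x` contains none of the patterns
listed in `L`, and it breaks the test vectors whose window is contained in this region. -/
def IsLocallyGood (L : List PatternTable) (n : ℕ) (x : ℤ × ℤ → ℕ) : Prop :=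
  (∀ w ∈ L, ∀ t < n, (∀ e ∈ w, encode (ofNat (ℤ × ℤ) t + e.1) < n) →
    ∃ e ∈ w, x (ofNat (ℤ × ℤ) t + e.1) ≠ e.2) ∧
  ∀ i < n, breakWindow i ≤ n → ∃ t < breakWindow i,
    encode (ofNat (ℤ × ℤ) t + testVector i) < breakWindow i ∧
    x (ofNat (ℤ × ℤ) t + testVector i) ≠ x (ofNat (ℤ × ℤ) t)

theorem IsLocallyGood.congr {L : List PatternTable} {n : ℕ} {x y : ℤ × ℤ → ℕ}
    (h : IsLocallyGood L n x) (hxy : ∀ z, encode z < n → x z = y z) : IsLocallyGood L n y := by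
  refine ⟨fun w hw t ht hwt => ?_, fun i hi hn => ?_⟩
  · obtain ⟨e, he, hne⟩ := h.1 w hw t ht hwt
    exact ⟨e, he, by rwa [← hxy _ (hwt e he)]⟩
  · obtain ⟨t, ht, ht', hne⟩ := h.2 i hi hn
    refine ⟨t, ht, ht', ?_⟩
    rwa [← hxy _ (by omega), ← hxy _ (by rw [encode_ofNat]; omega)]

theorem IsLocallyGood.mono {L : List PatternTable} {m n : ℕ} {x : ℤ × ℤ → ℕ}
    (h : IsLocallyGood L n x) (hmn : m ≤ n) : IsLocallyGood L m x :=
  ⟨fun w hw t ht hwt => h.1 w hw t (by omega) fun e he => (hwt e he).trans_le hmn,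
    fun i hi hm => h.2 i (by omega) (by omega)⟩

theorem mem_sft_iff {c : ForbiddenInput} {x : ℤ × ℤ → c.Alphabet} :
    x ∈ c.sft.carrier ↔ ∀ w ∈ c.1.2, ∀ z, ∃ e ∈ w, (x (z + e.1) : ℕ) ≠ e.2 := by
  have h : x ∈ c.sft.carrier ↔ ∀ w ∈ c.1.2, ∀ z, ¬ (w.toPattern c.1.1).occursInAt x z := by
    change x ∈ forbidden _ ↔ _
    simp only [forbidden, ForbiddenInput.patterns, patternSet, Set.mem_ofPred_eq,
      forall_exists_index, and_imp, forall_apply_eq_imp_iff₂]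
  rw [h]
  refine forall₂_congr fun w hw => forall_congr' fun z => ?_
  have hc : ∀ e ∈ w, ((w.toPattern c.1.1).config e.1 : ℕ) = e.2 :=
    fun e he => (c.2 w hw).config_eq he
  rw [← not_iff_not, not_not]
  push Not
  constructor
  · intro h e he
    rw [h e.1 (by simpa [PatternTable.toPattern] using ⟨e.2, he⟩), hc e he]
  · intro h g hg
    simp only [PatternTable.toPattern, List.mem_toFinset, List.mem_map] at hg
    obtain ⟨e, he, rfl⟩ := hg
    exact Fin.ext ((h e he).trans (hc e he).symm)

/-- Only the finitely many coordinates with code below `n` matter. -/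
theorem isClosed_isLocallyGood {k : ℕ} (L : List PatternTable) (n : ℕ) :
    IsClosed {x : ℤ × ℤ → Fin (k + 1) | IsLocallyGood L n fun z => x z} := by
  rw [← isOpen_compl_iff, isOpen_iff_mem_nhds]
  intro x hx
  let U : Finset (ℤ × ℤ) := (Finset.range n).image (ofNat (ℤ × ℤ))
  refine Filter.mem_of_superset ((isOpen_cylinder U x).mem_nhds (mem_cylinder.2 fun _ _ => rfl)) ?_
  intro y hy hgood
  refine hx (Set.mem_ofPred.2 ((Set.mem_ofPred.1 hgood).congr fun z hz => ?_))
  have hzU : z ∈ U := Finset.mem_image.2 ⟨encode z, Finset.mem_range.2 hz, ofNat_encode z⟩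
  rw [mem_cylinder.1 hy z hzU]

theorem exists_isLocallyGood_of_isAperiodic {c : ForbiddenInput} {x : ℤ × ℤ → c.Alphabet}
    (hx : x ∈ c.sft.carrier) (hap : IsAperiodic x) (n : ℕ) :
    ∃ y : ℤ × ℤ → c.Alphabet, IsLocallyGood c.1.2 n fun z => y z := by
  have hbr : ∀ i, ∃ D, BrokenNear x (testVector i) 0 D := by
    intro i
    have := isAperiodic_iff_forall_testVector.1 hap i
    simp only [Function.Periodic, not_forall] at this
    obtain ⟨y, hy⟩ := this
    exact ⟨_, y, le_rfl, hy⟩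
  choose D hD using hbr
  -- The initial radius depends on `x`, but it affects only the location of `z`, not the final
  -- radii.
  obtain ⟨z, -, hz⟩ := exists_nested_brokenNear (fun _ _ => supNorm_testVector_le)
    (fun _ _ => comparable_testVector) n ((Finset.range n).sup D) 0
    fun i hi => (hD i).mono (Finset.le_sup (Finset.mem_range.2 hi))
  refine ⟨fun y => x (z + y), fun w hw t _ _ => ?_, fun i hi _ => ?_⟩
  · simpa only [add_assoc] using mem_sft_iff.1 hx w hw (z + ofNat (ℤ × ℤ) t)
  · obtain ⟨y, hy, hne⟩ := hz i hi
    refine ⟨encode (y - z), encode_lt_of_supNorm_le (hy.trans (by omega)), ?_, ?_⟩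
    · rw [ofNat_encode]
      refine encode_lt_of_supNorm_le ?_
      have := supNorm_add_le (y - z) (testVector i)
      have := supNorm_testVector_le (Nat.lt_add_one i)
      omega
    · have h₁ : z + (y - z + testVector i) = y + testVector i := by abel
      have h₂ : z + (y - z) = y := by abel
      simp only [ofNat_encode, h₁, h₂]
      exact fun h => hne (Fin.ext h)

theorem exists_isAperiodic_of_isLocallyGood {c : ForbiddenInput}
    (h : ∀ n, ∃ x : ℤ × ℤ → c.Alphabet, IsLocallyGood c.1.2 n fun z => x z) :
    ∃ x ∈ c.sft.carrier, IsAperiodic x := by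
  obtain ⟨x, hx⟩ := IsCompact.nonempty_iInter_of_sequence_nonempty_isCompact_isClosed
    (fun n => {x : ℤ × ℤ → c.Alphabet | IsLocallyGood c.1.2 n fun z => x z})
    (fun n x hx => Set.mem_ofPred.2 ((Set.mem_ofPred.1 hx).mono n.le_succ)) h
    (isClosed_isLocallyGood _ _).isCompact (fun n => isClosed_isLocallyGood _ n)
  have hx : ∀ n, IsLocallyGood c.1.2 n fun z => x z := Set.mem_iInter.1 hx
  refine ⟨x, mem_sft_iff.2 fun w hw z => ?_, isAperiodic_iff_forall_testVector.2 fun i hper => ?_⟩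
  · let n := encode z + 1 + (w.map fun e => encode (z + e.1) + 1).sum
    have := (hx n).1 w hw (encode z) (by omega) fun e he => ?_
    · simpa only [ofNat_encode] using this
    · have := List.le_sum_of_mem (List.mem_map_of_mem (f := fun e => encode (z + e.1) + 1) he)
      rw [ofNat_encode]
      omega
  · obtain ⟨t, -, -, hne⟩ := (hx (max (i + 1) (breakWindow i))).2 i (by omega) (by omega)
    exact hne (congrArg Fin.val (hper _))

theorem exists_isAperiodic_iff (c : ForbiddenInput) :
    (∃ x ∈ c.sft.carrier, IsAperiodic x) ↔
      ∀ n, ∃ x : ℤ × ℤ → c.Alphabet, IsLocallyGood c.1.2 n fun z => x z :=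
  ⟨fun ⟨_, hx, hap⟩ => exists_isLocallyGood_of_isAperiodic hx hap,
    exists_isAperiodic_of_isLocallyGood⟩

/-! ### Reduction to a bounded search -/

theorem exists_code_of_digits (k : ℕ) (d : ℕ → ℕ) (hd : ∀ i, d i ≤ k) (n : ℕ) :
    ∃ u < (k + 1) ^ n, ∀ i < n, u / (k + 1) ^ i % (k + 1) = d i := by
  induction n with
  | zero => exact ⟨0, by simp, by simp⟩
  | succ n ih =>
    obtain ⟨u, hu, h⟩ := ih
    refine ⟨d n * (k + 1) ^ n + u, ?_, fun i hi => ?_⟩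
    · have := Nat.mul_le_mul_right ((k + 1) ^ n) (hd n)
      rw [pow_succ, mul_comm ((k + 1) ^ n), add_mul, one_mul]
      omega
    · rcases Nat.lt_succ_iff_lt_or_eq.1 hi with hi | rfl
      · rw [← h i hi]
        obtain ⟨r, rfl⟩ := Nat.exists_eq_add_of_lt hi
        rw [show d (i + r + 1) * (k + 1) ^ (i + r + 1) + u =
          u + (k + 1) ^ i * (d (i + r + 1) * (k + 1) ^ r * (k + 1)) by ring,
          Nat.add_mul_div_left _ _ (by positivity), Nat.add_mul_mod_self_right]
      · rw [add_comm, Nat.add_mul_div_right _ _ (by positivity), Nat.div_eq_of_lt hu, zero_add,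
          Nat.mod_eq_of_lt (by have := hd i; omega)]

/-- The configuration whose letters are the digits of `u` in base `k + 1`. -/
def digitConfig (k u : ℕ) (z : ℤ × ℤ) : ℕ := u / (k + 1) ^ encode z % (k + 1)

/-- The values on the first `n` positions form the base `k + 1` digits of a number; other positions
are irrelevant. -/
theorem exists_isLocallyGood_iff (k : ℕ) (L : List PatternTable) (n : ℕ) :
    (∃ x : ℤ × ℤ → Fin (k + 1), IsLocallyGood L n fun z => x z) ↔
      ∃ u ∈ List.range ((k + 1) ^ n), IsLocallyGood L n (digitConfig k u) := by
  constructor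
  · rintro ⟨x, hx⟩
    obtain ⟨u, hu, h⟩ := exists_code_of_digits k (fun i => x (ofNat (ℤ × ℤ) i))
      (fun i => Nat.lt_succ_iff.1 (x _).2) n
    refine ⟨u, List.mem_range.2 hu, hx.congr fun z hz => ?_⟩
    rw [digitConfig, h _ hz, ofNat_encode]
  · rintro ⟨u, -, h⟩
    exact ⟨fun z => ⟨digitConfig k u z, Nat.mod_lt _ (by omega)⟩, h⟩

/-! ### Primitive recursiveness of the certificates -/

theorem Primrec.nat_pow : Primrec₂ ((· ^ ·) : ℕ → ℕ → ℕ) := Primrec₂.unpaired'.1 Nat.Primrec.pow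

theorem Primrec.nat_factorial : Primrec Nat.factorial :=
  (Primrec.nat_rec₁ 1 (f := fun n r => (n + 1) * r)
    (Primrec.nat_mul.comp (Primrec.succ.comp Primrec.fst) Primrec.snd)).of_eq fun n => by
    induction n with
    | zero => rfl
    | succ n ih => rw [Nat.factorial_succ, ← ih]

theorem encode_natCast_sub (a b : ℕ) :
    encode ((a : ℤ) - b) = if b ≤ a then 2 * (a - b) else 2 * (b - a - 1) + 1 := by
  split_ifs with h
  · rw [← Nat.cast_sub h]
    rfl
  · rw [show (a : ℤ) - b = Int.negSucc (b - a - 1) by omega]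
    rfl

theorem Primrec.int_natCast_sub : Primrec₂ fun a b : ℕ => (a : ℤ) - b := by
  refine Primrec₂.encode_iff.1 (Primrec₂.of_eq ?_ fun a b => (encode_natCast_sub a b).symm)
  have hsub : Primrec₂ fun a b : ℕ => b - a := Primrec.nat_sub.comp Primrec.snd Primrec.fst
  exact Primrec.ite (Primrec.nat_le.comp Primrec.snd Primrec.fst)
    (Primrec.nat_double.comp Primrec.nat_sub)
    (Primrec.nat_double_succ.comp (Primrec.pred.comp hsub))

theorem Primrec.int_natCast : Primrec fun a : ℕ => (a : ℤ) :=
  (Primrec.int_natCast_sub.comp Primrec.id (Primrec.const 0)).of_eq fun a => by simp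

theorem Primrec.int_toNat : Primrec Int.toNat := by
  refine Primrec.of_eq (Primrec.ite (Primrec.eq.comp (Primrec.nat_mod.comp Primrec.encode
    (Primrec.const 2)) (Primrec.const 0)) (Primrec.nat_div.comp Primrec.encode (Primrec.const 2))
    (Primrec.const 0)) fun z => ?_
  cases z with
  | ofNat n =>
    have : encode (Int.ofNat n) = 2 * n := rfl
    rw [this, if_pos (by omega)]
    simp
  | negSucc n =>
    have : encode (Int.negSucc n) = 2 * n + 1 := rfl
    rw [this, if_neg (by omega)]
    rfl

theorem Primrec.int_neg_toNat : Primrec fun z : ℤ => (-z).toNat := by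
  refine Primrec.of_eq (Primrec.ite (Primrec.eq.comp (Primrec.nat_mod.comp Primrec.encode
    (Primrec.const 2)) (Primrec.const 0)) (Primrec.const 0)
    (Primrec.succ.comp (Primrec.nat_div.comp Primrec.encode (Primrec.const 2)))) fun z => ?_
  cases z with
  | ofNat n =>
    have : encode (Int.ofNat n) = 2 * n := rfl
    rw [this, if_pos (by omega)]
    simp
  | negSucc n =>
    have : encode (Int.negSucc n) = 2 * n + 1 := rfl
    rw [this, if_neg (by omega)]
    change _ = n + 1
    omega

theorem Primrec.int_add : Primrec₂ ((· + ·) : ℤ → ℤ → ℤ) := by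
  -- Positive and negative parts are added separately and then subtracted.
  refine Primrec.of_eq (Primrec.int_natCast_sub.comp
    (Primrec.nat_add.comp (Primrec.int_toNat.comp Primrec.fst) (Primrec.int_toNat.comp Primrec.snd))
    (Primrec.nat_add.comp (Primrec.int_neg_toNat.comp Primrec.fst)
      (Primrec.int_neg_toNat.comp Primrec.snd))) fun q => ?_
  change _ = q.1 + q.2
  omega

theorem Primrec.int_prod_add : Primrec₂ ((· + ·) : ℤ × ℤ → ℤ × ℤ → ℤ × ℤ) :=
  Primrec.pair
    (Primrec.int_add.comp (Primrec.fst.comp Primrec.fst) (Primrec.fst.comp Primrec.snd))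
    (Primrec.int_add.comp (Primrec.snd.comp Primrec.fst) (Primrec.snd.comp Primrec.snd))

theorem primrec_periodFactor : Primrec periodFactor :=
  Primrec.nat_pow.comp Primrec.nat_factorial Primrec.id

theorem primrec_testBound : Primrec testBound :=
  Primrec.nat_mul.comp primrec_periodFactor Primrec.succ

theorem primrec_driftBound {M : ℕ → ℕ} (hM : Primrec M) : Primrec (driftBound M) := by
  refine (Primrec.nat_rec₁ 0
    (f := fun k r => r + 2 * M (k + 1) * (k + 1) * (4 * M k * M k + 1) ^ k) ?_).of_eq fun n => ?_
  · have h1 : Primrec fun q : ℕ × ℕ => M q.1 := hM.comp Primrec.fst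
    have h2 : Primrec fun q : ℕ × ℕ => q.1 + 1 := Primrec.succ.comp Primrec.fst
    exact Primrec.nat_add.comp Primrec.snd (Primrec.nat_mul.comp
      (Primrec.nat_mul.comp (Primrec.nat_double.comp (hM.comp h2)) h2)
      (Primrec.nat_pow.comp (Primrec.succ.comp (Primrec.nat_mul.comp
        (Primrec.nat_mul.comp (Primrec.const 4) h1) h1)) Primrec.fst))
  · induction n with
    | zero => rfl
    | succ n ih => rw [driftBound, ← ih]

theorem primrec_breakRadius {M : ℕ → ℕ} (hM : Primrec M) : Primrec (breakRadius M) :=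
  Primrec.nat_add.comp
    (Primrec.nat_mul.comp (Primrec.nat_double.comp (hM.comp Primrec.succ)) Primrec.succ)
    ((primrec_driftBound hM).comp Primrec.succ)

theorem primrec_breakWindow : Primrec breakWindow :=
  Primrec.nat_pow.comp (Primrec.nat_double_succ.comp (Primrec.nat_add.comp
    (primrec_breakRadius primrec_testBound) (primrec_testBound.comp Primrec.succ)))
    (Primrec.const 2)

theorem primrec_testVector : Primrec testVector := by
  have ha : Primrec fun k : ℕ => k.unpair.1 := Primrec.fst.comp Primrec.unpair
  have hr : Primrec fun k : ℕ => k.unpair.2.unpair :=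
    Primrec.unpair.comp (Primrec.snd.comp Primrec.unpair)
  have hb := Primrec.fst.comp hr
  have hc := Primrec.snd.comp hr
  have hg := primrec_periodFactor
  refine Primrec.of_eq (Primrec.ite
    ((Primrec.eq.comp ha (Primrec.const 0)).and (Primrec.eq.comp hb hc))
    (Primrec.pair (Primrec.const 0) (Primrec.int_natCast.comp hg))
    (Primrec.pair (Primrec.int_natCast.comp (Primrec.nat_mul.comp hg ha))
      (Primrec.int_natCast_sub.comp (Primrec.nat_mul.comp hg hb) (Primrec.nat_mul.comp hg hc))))
    fun k => ?_
  rw [testVector, nonzeroVector, smul_ite]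
  congr 1
  · simp
  · simp [mul_sub]

theorem primrec_digitConfig :
    Primrec fun q : (ℕ × ℕ) × (ℤ × ℤ) => digitConfig q.1.1 q.1.2 q.2 := by
  have hk : Primrec fun q : (ℕ × ℕ) × (ℤ × ℤ) => q.1.1 + 1 :=
    Primrec.succ.comp (Primrec.fst.comp Primrec.fst)
  exact Primrec.nat_mod.comp (Primrec.nat_div.comp (Primrec.snd.comp Primrec.fst)
    (Primrec.nat_pow.comp hk (Primrec.encode.comp Primrec.snd))) hk

theorem primrecPred_isLocallyGood : PrimrecPred fun q : (ℕ × List PatternTable) × (ℕ × ℕ) =>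
    IsLocallyGood q.1.2 q.2.2 (digitConfig q.1.1 q.2.1) := by
  have hadd : Primrec₂ fun (t : ℕ) (v : ℤ × ℤ) => ofNat (ℤ × ℤ) t + v :=
    Primrec.int_prod_add.comp ((Primrec.ofNat _).comp Primrec.fst) Primrec.snd
  have hin : PrimrecRel fun (e : (ℤ × ℤ) × ℕ) (s : ℕ × ((ℕ × ℕ) × ℕ)) =>
      encode (ofNat (ℤ × ℤ) s.1 + e.1) < s.2.2 :=
    Primrec.nat_lt.comp (Primrec.encode.comp (hadd.comp (Primrec.fst.comp Primrec.snd)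
      (Primrec.fst.comp Primrec.fst))) (Primrec.snd.comp (Primrec.snd.comp Primrec.snd))
  have hne : PrimrecRel fun (e : (ℤ × ℤ) × ℕ) (s : ℕ × ((ℕ × ℕ) × ℕ)) =>
      digitConfig s.2.1.1 s.2.1.2 (ofNat (ℤ × ℤ) s.1 + e.1) ≠ e.2 :=
    (Primrec.eq.comp (primrec_digitConfig.comp (Primrec.pair
      (Primrec.fst.comp (Primrec.snd.comp Primrec.snd))
      (hadd.comp (Primrec.fst.comp Primrec.snd) (Primrec.fst.comp Primrec.fst))))
      (Primrec.snd.comp Primrec.fst)).not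
  have hw : PrimrecRel fun (t : ℕ) (s : PatternTable × ((ℕ × ℕ) × ℕ)) =>
      (∀ e ∈ s.1, encode (ofNat (ℤ × ℤ) t + e.1) < s.2.2) →
        ∃ e ∈ s.1, digitConfig s.2.1.1 s.2.1.2 (ofNat (ℤ × ℤ) t + e.1) ≠ e.2 := by
    have hl : Primrec fun r : ℕ × (PatternTable × ((ℕ × ℕ) × ℕ)) => r.2.1 :=
      Primrec.fst.comp Primrec.snd
    have hs : Primrec fun r : ℕ × (PatternTable × ((ℕ × ℕ) × ℕ)) => (r.1, r.2.2) :=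
      Primrec.pair Primrec.fst (Primrec.snd.comp Primrec.snd)
    exact ((hin.forall_mem_list.comp hl hs).not.or (hne.exists_mem_list.comp hl hs)).of_eq
      fun r => by simp only [imp_iff_not_or]
  have hw' : PrimrecRel fun (w : PatternTable) (s : (ℕ × ℕ) × ℕ) => ∀ t ∈ List.range s.2,
      (∀ e ∈ w, encode (ofNat (ℤ × ℤ) t + e.1) < s.2) →
        ∃ e ∈ w, digitConfig s.1.1 s.1.2 (ofNat (ℤ × ℤ) t + e.1) ≠ e.2 :=
    hw.forall_mem_list.comp (Primrec.list_range.comp (Primrec.snd.comp Primrec.snd)) Primrec.id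
  have hbreak : PrimrecRel fun (t : ℕ) (s : ℕ × (ℕ × ℕ)) =>
      encode (ofNat (ℤ × ℤ) t + testVector s.1) < breakWindow s.1 ∧
      digitConfig s.2.1 s.2.2 (ofNat (ℤ × ℤ) t + testVector s.1) ≠
        digitConfig s.2.1 s.2.2 (ofNat (ℤ × ℤ) t) := by
    have hi : Primrec fun r : ℕ × (ℕ × (ℕ × ℕ)) => r.2.1 := Primrec.fst.comp Primrec.snd
    have hu : Primrec fun r : ℕ × (ℕ × (ℕ × ℕ)) => r.2.2 := Primrec.snd.comp Primrec.snd
    have hz := hadd.comp (Primrec.fst (α := ℕ) (β := ℕ × (ℕ × ℕ))) (primrec_testVector.comp hi)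
    exact (Primrec.nat_lt.comp (Primrec.encode.comp hz) (primrec_breakWindow.comp hi)).and
      (Primrec.eq.comp (primrec_digitConfig.comp (Primrec.pair hu hz))
        (primrec_digitConfig.comp (Primrec.pair hu ((Primrec.ofNat _).comp Primrec.fst)))).not
  have hbreak' : PrimrecRel fun (i : ℕ) (s : (ℕ × ℕ) × ℕ) => breakWindow i ≤ s.2 →
      ∃ t ∈ List.range (breakWindow i),
        encode (ofNat (ℤ × ℤ) t + testVector i) < breakWindow i ∧
        digitConfig s.1.1 s.1.2 (ofNat (ℤ × ℤ) t + testVector i) ≠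
          digitConfig s.1.1 s.1.2 (ofNat (ℤ × ℤ) t) := by
    have hG : Primrec fun r : ℕ × ((ℕ × ℕ) × ℕ) => breakWindow r.1 :=
      primrec_breakWindow.comp Primrec.fst
    exact ((Primrec.nat_le.comp hG (Primrec.snd.comp Primrec.snd)).not.or
      (hbreak.exists_mem_list.comp (Primrec.list_range.comp hG)
        (Primrec.pair Primrec.fst (Primrec.fst.comp Primrec.snd)))).of_eq
      fun r => by simp only [imp_iff_not_or]
  have hs : Primrec fun q : (ℕ × List PatternTable) × (ℕ × ℕ) => ((q.1.1, q.2.1), q.2.2) :=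
    Primrec.pair (Primrec.pair (Primrec.fst.comp Primrec.fst) (Primrec.fst.comp Primrec.snd))
      (Primrec.snd.comp Primrec.snd)
  refine ((hw'.forall_mem_list.comp (Primrec.snd.comp Primrec.fst) hs).and
    (hbreak'.forall_mem_list.comp (Primrec.list_range.comp (Primrec.snd.comp Primrec.snd)) hs)).of_eq
    fun q => ?_
  simp only [IsLocallyGood, List.mem_range]

/-! ### Enumerating the negative instances -/

theorem REPred.exists_nat {α : Type*} [Primcodable α] {R : α × ℕ → Prop} (hR : PrimrecPred R) :
    REPred fun a => ∃ n, R (a, n) := by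
  classical
  have h : Partrec fun a => Nat.rfind fun n => Part.some (decide (R (a, n))) :=
    Partrec.rfind hR.decide.to_comp.partrec
  refine h.dom_re.of_eq fun a => ?_
  refine Nat.rfind_dom'.trans ?_
  simp

theorem mainTheorem4 :
    IsPi01 fun c : ForbiddenInput => ∃ x ∈ c.sft.carrier, IsAperiodic x := by
  have hgood : PrimrecRel fun (u : ℕ) (s : (ℕ × List PatternTable) × ℕ) =>
      IsLocallyGood s.1.2 s.2 (digitConfig s.1.1 u) :=
    primrecPred_isLocallyGood.comp (Primrec.pair (Primrec.fst.comp Primrec.snd)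
      (Primrec.pair Primrec.fst (Primrec.snd.comp Primrec.snd)))
  have hex : PrimrecPred fun s : (ℕ × List PatternTable) × ℕ =>
      ∃ u ∈ List.range ((s.1.1 + 1) ^ s.2), IsLocallyGood s.1.2 s.2 (digitConfig s.1.1 u) :=
    hgood.exists_mem_list.comp (Primrec.list_range.comp (Primrec.nat_pow.comp
      (Primrec.succ.comp (Primrec.fst.comp Primrec.fst)) Primrec.snd)) Primrec.id
  have hval : Primrec fun c : ForbiddenInput => c.1 := Primrec.subtype_val
  -- The search is for an `n` at which no digit code is locally good.
  refine (REPred.exists_nat (hex.not.comp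
    (Primrec.pair (hval.comp Primrec.fst) Primrec.snd))).of_eq fun c => ?_
  refine Iff.trans ?_ (not_congr (exists_isAperiodic_iff c)).symm
  rw [not_forall]
  exact exists_congr fun n => not_congr (exists_isLocallyGood_iff _ _ _).symm
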